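/- **Proposition (Vanishing System Entropy Contribution).** Let $d\ge 0$, let $U:\mathbb{R}^d\to\mathbb{R}^d$ be globally Lipschitz, let $\mu\in\mathbb{R}^d$ and $\tau>0$. Let $\theta_k\sim\mathcal N(\mu,\tau I)$ and $\varepsilon\sim\mathcal N(0,I)$ be independent random vectors in $\mathbb{R}^d$, and for $\eta>0$ and $\sigma\neq 0$ put $$\theta_{k+1}=\theta_k-\eta\,U(\theta_k)+\sigma\varepsilon .$$ For a random vector $X$ with Lebesgue density $p$ such that $p\ln p$ is integrable, let $H(X)=-\int_{\mathbb{R}^d}p\ln p\,dx$ denote its Shannon (differential) entropy, and let $\Delta S_{\mathrm{sys}}=H(\theta_{k+1})-H(\theta_k)$. Then $\theta_k$ and, for all $\eta>0$ and $\sigma\ne0$, $\theta_{k+1}$ have Lebesgue densities and finite Shannon entropy, and with $\mu$, $\tau$ and $U$ held fixed $$\lim_{\sigma\to 0}\sigma^2\,\Delta S_{\mathrm{sys}}=0,$$ both when $\eta>0$ is held fixed and when $\eta=c\,\sigma^2$ for a fixed constant $c>0$. -/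

import Mathlib

open MeasureTheory ProbabilityTheory Filter Topology

noncomputable section

/-- One step of the noisy update with step size `η`, noise scale `σ` and noise vector `e`:
`θ ↦ θ - η U(θ) + σ e`. -/
def noisyUpdate {d : ℕ} (U : EuclideanSpace ℝ (Fin d) → EuclideanSpace ℝ (Fin d))
    (η σ : ℝ) (θ e : EuclideanSpace ℝ (Fin d)) : EuclideanSpace ℝ (Fin d) :=
  θ - η • U θ + σ • e

/-- The Lebesgue density of a law on `ℝ^d` (meaningful when the law is absolutely continuous). -/
def lebesgueDensity {d : ℕ} (ν : Measure (EuclideanSpace ℝ (Fin d)))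
    (x : EuclideanSpace ℝ (Fin d)) : ℝ :=
  (ν.rnDeriv volume x).toReal

/-- The law `ν` has a Lebesgue density `p`, and `p log p` is Lebesgue integrable: the Shannon
(differential) entropy of `ν` exists and is finite. -/
def HasShannonEntropy {d : ℕ} (ν : Measure (EuclideanSpace ℝ (Fin d))) : Prop :=
  ν ≪ volume ∧
    Integrable (fun x => lebesgueDensity ν x * Real.log (lebesgueDensity ν x)) volume

/-- The Shannon (differential) entropy `H(ν) = - ∫ p log p`, with `p` the Lebesgue density of `ν`
(and `0 log 0 = 0`). -/
def shannonEntropy {d : ℕ} (ν : Measure (EuclideanSpace ℝ (Fin d))) : ℝ :=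
  - ∫ x, lebesgueDensity ν x * Real.log (lebesgueDensity ν x)

/-- The change of system entropy `H(law of θ_{k+1}) - H(law of θ_k)` in one noisy update, where
`θ` is the random state and `ε` the random noise. -/
def systemEntropyChange {Ω : Type*} [MeasurableSpace Ω] {d : ℕ} (P : Measure Ω)
    (U : EuclideanSpace ℝ (Fin d) → EuclideanSpace ℝ (Fin d))
    (θ ε : Ω → EuclideanSpace ℝ (Fin d)) (η σ : ℝ) : ℝ :=
  shannonEntropy (P.map (fun ω => noisyUpdate U η σ (θ ω) (ε ω))) - shannonEntropy (P.map θ)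

end

/-! Since `H(θ_k)` is finite and independent of `σ`, and `σ² log |σ| → 0`, it suffices that
`|H(θ_{k+1})| ≤ d |log |σ|| + O(1)` as `σ → 0`. Adding independent noise of scale `σ` caps the
density at `|σ|⁻ᵈ`, whatever the law of `θ - η U(θ)` (`map_add_smul_le_smul_volume`); this bounds
the entropy below. The second moment bounds it above, by comparison with `exp (-‖x‖²)`; both bounds
are in `abs_shannonEntropy_le`. The second moment stays bounded as long as `η` does, so both regimes
are cases of a convergent step size `η(σ)`. -/

/-- Finite products of σ-finite measures are monotone in the factors. -/
lemma MeasureTheory.Measure.pi_le_pi {ι : Type*} [Fintype ι] {α : ι → Type*}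
    [∀ i, MeasurableSpace (α i)] {μ ν : ∀ i, Measure (α i)} [∀ i, SigmaFinite (μ i)]
    (h : ∀ i, μ i ≤ ν i) : Measure.pi μ ≤ Measure.pi ν := by
  -- `OuterMeasure.pi` is the largest outer measure bounded on boxes by the product of the side
  -- masses, so only boxes need checking.
  have key : (Measure.pi μ).toOuterMeasure ≤ OuterMeasure.pi fun i => (ν i).toOuterMeasure := by
    rw [OuterMeasure.le_pi]
    intro s _
    change Measure.pi μ (Set.pi Set.univ s) ≤ _
    rw [Measure.pi_pi]
    exact Finset.prod_le_prod' fun i _ => h i (s i)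
  refine Measure.le_iff.2 fun s hs => ?_
  rw [Measure.pi_def ν, toMeasure_apply _ _ hs]
  exact key s

/-- The density is at most `1/√(2π) < 1`. -/
lemma gaussianReal_zero_one_le_volume : gaussianReal 0 1 ≤ (volume : Measure ℝ) := by
  rw [gaussianReal_of_var_ne_zero _ one_ne_zero]
  calc volume.withDensity (gaussianPDF 0 1) ≤ volume.withDensity 1 := by
        refine withDensity_mono (ae_of_all _ fun x => ?_)
        rw [gaussianPDF, Pi.one_apply, ENNReal.ofReal_le_one, gaussianPDFReal]
        refine mul_le_one₀ (inv_le_one_of_one_le₀ ?_) (Real.exp_pos _).le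
          (Real.exp_le_one_iff.2 ?_)
        · rw [Real.one_le_sqrt]
          have := Real.pi_gt_three
          push_cast
          linarith
        · push_cast
          have := sq_nonneg (x - 0)
          linarith
    _ = volume := withDensity_one

lemma stdGaussian_le_volume {d : ℕ} :
    stdGaussian (EuclideanSpace ℝ (Fin d)) ≤ (volume : Measure (EuclideanSpace ℝ (Fin d))) := by
  rw [← map_pi_eq_stdGaussian, ← (PiLp.volume_preserving_toLp (Fin d)).map_eq]
  exact Measure.map_mono
    (Measure.pi_le_pi fun _ => gaussianReal_zero_one_le_volume) (by fun_prop)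

/-- Adding independent Gaussian noise of scale `σ` yields a law whose Lebesgue density is at most
`|σ|⁻ᵈ`. -/
lemma map_add_smul_le_smul_volume {Ω : Type*} [MeasurableSpace Ω] {P : Measure Ω}
    [IsProbabilityMeasure P] {d : ℕ} {Z ε : Ω → EuclideanSpace ℝ (Fin d)}
    (hZ : AEMeasurable Z P) (hε : HasLaw ε (stdGaussian (EuclideanSpace ℝ (Fin d))) P)
    (hindep : IndepFun Z ε P) {σ : ℝ} (hσ : σ ≠ 0) :
    P.map (fun ω => Z ω + σ • ε ω) ≤ ENNReal.ofReal ((|σ| ^ d)⁻¹) • volume := by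
  have : IsProbabilityMeasure (P.map Z) := Measure.isProbabilityMeasure_map hZ
  have hprod := (indepFun_iff_map_prod_eq_prod_map_map hZ hε.aemeasurable).1 hindep
  rw [hε.map_eq] at hprod
  refine Measure.le_iff.2 fun s hs => ?_
  have hf : Measurable fun p : EuclideanSpace ℝ (Fin d) × EuclideanSpace ℝ (Fin d) =>
      p.1 + σ • p.2 := by fun_prop
  have hmap : P.map (fun ω => Z ω + σ • ε ω) =
      ((P.map Z).prod (stdGaussian (EuclideanSpace ℝ (Fin d)))).map
        (fun p => p.1 + σ • p.2) := by
    rw [← hprod, AEMeasurable.map_map_of_aemeasurable hf.aemeasurable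
      (hZ.prodMk hε.aemeasurable)]
    rfl
  rw [hmap, Measure.map_apply hf hs, Measure.prod_apply (hf hs)]
  have hslice : ∀ z : EuclideanSpace ℝ (Fin d),
      stdGaussian (EuclideanSpace ℝ (Fin d))
        (Prod.mk z ⁻¹' ((fun p => p.1 + σ • p.2) ⁻¹' s)) ≤
      ENNReal.ofReal ((|σ| ^ d)⁻¹) * volume s := by
    intro z
    -- With `Z = z` fixed, the noise must lie in a translate of `s` rescaled by `σ⁻¹`.
    refine (stdGaussian_le_volume _).trans (le_of_eq ?_)
    have : Prod.mk z ⁻¹' ((fun p => p.1 + σ • p.2) ⁻¹' s) =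
        (σ • ·) ⁻¹' ((z + ·) ⁻¹' s) := rfl
    rw [this, Measure.addHaar_preimage_smul _ hσ, measure_preimage_add]
    simp [abs_inv, abs_pow]
  calc _ ≤ ∫⁻ _, ENNReal.ofReal ((|σ| ^ d)⁻¹) * volume s ∂(P.map Z) := lintegral_mono hslice
    _ = _ := by simp

/-! ### Entropy bounds from a density bound and a second moment. -/

/-- Pointwise control of `p log p` by a bound `M` on `p` and comparison with a reference
density `exp (-r)`. -/
lemma abs_mul_log_le {p M r : ℝ} (hp : 0 ≤ p) (hpM : p ≤ M) (hr : 0 ≤ r) :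
    |p * Real.log p| ≤ p * |Real.log M| + p * r + Real.exp (-r) := by
  rcases hp.eq_or_lt with rfl | hp
  · simpa using (Real.exp_pos (-r)).le
  have h1 : p * Real.log p ≤ p * |Real.log M| :=
    mul_le_mul_of_nonneg_left ((Real.log_le_log hp hpM).trans (le_abs_self _)) hp.le
  -- This is `1 + t ≤ exp t` at `t = -r - log p`, multiplied by `p`.
  have h2 : p * (-r - Real.log p) ≤ Real.exp (-r) := by
    have h := Real.add_one_le_exp (-r - Real.log p)
    rw [Real.exp_sub, Real.exp_log hp, le_div_iff₀ hp] at h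
    nlinarith
  have h3 : 0 ≤ p * |Real.log M| := by positivity
  have h4 : 0 ≤ p * r := by positivity
  have := Real.exp_pos (-r)
  rw [abs_le]
  constructor <;> nlinarith

lemma integrable_exp_neg_sq_norm {d : ℕ} :
    Integrable fun x : EuclideanSpace ℝ (Fin d) => Real.exp (-‖x‖ ^ 2) := by
  have h := (GaussianFourier.integrable_cexp_neg_mul_sq_norm_add (b := 1) (by simp) 0
    (0 : EuclideanSpace ℝ (Fin d))).norm
  refine h.congr (ae_of_all _ fun x => ?_)
  simp only [Complex.norm_exp]
  congr 1
  simp [← Complex.ofReal_pow]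

section BoundedDensity

variable {d : ℕ} {ν : Measure (EuclideanSpace ℝ (Fin d))} [IsProbabilityMeasure ν] {M : ℝ}

lemma abs_lebesgueDensity_mul_log_le (hM : 0 ≤ M) (hν : ν ≤ ENNReal.ofReal M • volume) :
    ∀ᵐ x, |lebesgueDensity ν x * Real.log (lebesgueDensity ν x)| ≤
      lebesgueDensity ν x * |Real.log M| + lebesgueDensity ν x * ‖x‖ ^ 2 +
        Real.exp (-‖x‖ ^ 2) := by
  have hac : ν ≪ volume := Measure.absolutelyContinuous_of_le_smul hν
  have hle : ν.rnDeriv volume ≤ᵐ[volume] fun _ => ENNReal.ofReal M := by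
    refine ae_le_of_forall_setLIntegral_le_of_sigmaFinite (Measure.measurable_rnDeriv _ _)
      fun s hs _ => ?_
    rw [Measure.setLIntegral_rnDeriv hac, setLIntegral_const]
    exact hν s
  filter_upwards [hle] with x hx
  exact abs_mul_log_le ENNReal.toReal_nonneg (ENNReal.toReal_le_of_le_ofReal hM hx) (sq_nonneg _)

/-- The integrable majorant of `p log p` together with its integral. -/
lemma integrable_lebesgueDensity_majorant (hν : ν ≤ ENNReal.ofReal M • volume)
    (h2 : Integrable (fun x => ‖x‖ ^ 2) ν) :
    Integrable (fun x => lebesgueDensity ν x * |Real.log M| + lebesgueDensity ν x * ‖x‖ ^ 2 +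
        Real.exp (-‖x‖ ^ 2)) ∧
    ∫ x, (lebesgueDensity ν x * |Real.log M| + lebesgueDensity ν x * ‖x‖ ^ 2 +
        Real.exp (-‖x‖ ^ 2)) =
      |Real.log M| + ∫ x, ‖x‖ ^ 2 ∂ν +
        ∫ x : EuclideanSpace ℝ (Fin d), Real.exp (-‖x‖ ^ 2) := by
  have hac : ν ≪ volume := Measure.absolutelyContinuous_of_le_smul hν
  have i1 : Integrable (fun x => lebesgueDensity ν x * |Real.log M|) :=
    Measure.integrable_toReal_rnDeriv.mul_const _
  have i2 : Integrable (fun x => lebesgueDensity ν x * ‖x‖ ^ 2) :=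
    (integrable_rnDeriv_smul_iff hac).2 h2
  have e1 : ∫ x, lebesgueDensity ν x = 1 := by
    simpa [lebesgueDensity] using Measure.integral_toReal_rnDeriv hac
  have e2 : ∫ x, lebesgueDensity ν x * ‖x‖ ^ 2 = ∫ x, ‖x‖ ^ 2 ∂ν :=
    integral_rnDeriv_smul hac
  have i12 : Integrable
      (fun x => lebesgueDensity ν x * |Real.log M| + lebesgueDensity ν x * ‖x‖ ^ 2) := i1.add i2
  refine ⟨i12.add integrable_exp_neg_sq_norm, ?_⟩
  rw [integral_add i12 integrable_exp_neg_sq_norm, integral_add i1 i2,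
    integral_mul_const, e1, e2, one_mul]

/-- A law with bounded Lebesgue density and finite second moment has finite Shannon entropy. -/
lemma hasShannonEntropy_of_le_smul_volume (hM : 0 ≤ M) (hν : ν ≤ ENNReal.ofReal M • volume)
    (h2 : Integrable (fun x => ‖x‖ ^ 2) ν) : HasShannonEntropy ν := by
  refine ⟨Measure.absolutelyContinuous_of_le_smul hν,
    (integrable_lebesgueDensity_majorant hν h2).1.mono' ?_
      (abs_lebesgueDensity_mul_log_le hM hν)⟩
  have hm : Measurable (lebesgueDensity ν) := (Measure.measurable_rnDeriv _ _).ennreal_toReal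
  exact (hm.mul hm.log).aestronglyMeasurable

lemma abs_shannonEntropy_le (hM : 0 ≤ M) (hν : ν ≤ ENNReal.ofReal M • volume)
    (h2 : Integrable (fun x => ‖x‖ ^ 2) ν) :
    |shannonEntropy ν| ≤ |Real.log M| + ∫ x, ‖x‖ ^ 2 ∂ν +
      ∫ x : EuclideanSpace ℝ (Fin d), Real.exp (-‖x‖ ^ 2) := by
  obtain ⟨hi, he⟩ := integrable_lebesgueDensity_majorant hν h2
  rw [shannonEntropy, abs_neg, ← he]
  rw [← Real.norm_eq_abs]
  refine norm_integral_le_of_norm_le hi ?_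
  simpa only [Real.norm_eq_abs] using abs_lebesgueDensity_mul_log_le hM hν

end BoundedDensity

/-! ### The initial law and the logarithmic limit. -/

lemma multivariateGaussian_smul_one {d : ℕ} (μ : EuclideanSpace ℝ (Fin d)) {τ : ℝ} (hτ : 0 ≤ τ) :
    multivariateGaussian μ (τ • (1 : Matrix (Fin d) (Fin d) ℝ)) =
      (stdGaussian (EuclideanSpace ℝ (Fin d))).map (fun x => μ + √τ • x) := by
  open scoped MatrixOrder Matrix.Norms.L2Operator in
  have h : CFC.sqrt (τ • (1 : Matrix (Fin d) (Fin d) ℝ)) =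
      √τ • (1 : Matrix (Fin d) (Fin d) ℝ) := by
    refine CFC.sqrt_unique ?_ (hb := ?_)
    · rw [smul_mul_smul_comm, Real.mul_self_sqrt hτ, one_mul]
    · exact (Matrix.PosSemidef.one.smul (Real.sqrt_nonneg τ)).nonneg
  rw [multivariateGaussian, h]
  simp

lemma multivariateGaussian_smul_one_le {d : ℕ} (μ : EuclideanSpace ℝ (Fin d)) {τ : ℝ}
    (hτ : 0 < τ) :
    multivariateGaussian μ (τ • (1 : Matrix (Fin d) (Fin d) ℝ)) ≤
      ENNReal.ofReal ((|√τ| ^ d)⁻¹) • volume := by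
  rw [multivariateGaussian_smul_one μ hτ.le]
  -- The initial state is the constant `μ` plus noise of scale `√τ`.
  exact map_add_smul_le_smul_volume aemeasurable_const HasLaw.id (indepFun_const_left _ _)
    (Real.sqrt_pos.2 hτ).ne'

lemma tendsto_sq_mul_log_abs :
    Tendsto (fun σ : ℝ => σ ^ 2 * |Real.log σ|) (𝓝[≠] 0) (𝓝 0) := by
  -- One factor `|σ|` is split off because `σ log σ` extends continuously by `0`.
  have h : Continuous fun σ : ℝ => |σ| * |σ * Real.log σ| :=
    continuous_abs.mul Real.continuous_mul_log.abs
  have h0 := (h.tendsto 0).mono_left (nhdsWithin_le_nhds (s := {0}ᶜ))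
  simp only [abs_zero, zero_mul] at h0
  refine h0.congr fun σ => ?_
  rw [abs_mul, ← mul_assoc, abs_mul_abs_self, sq]

/-! ### Moments of the updated state and the limit. -/

section NoisyUpdate

variable {Ω : Type*} [MeasurableSpace Ω] {P : Measure Ω} {d : ℕ}
  {U : EuclideanSpace ℝ (Fin d) → EuclideanSpace ℝ (Fin d)}
  {θ ε : Ω → EuclideanSpace ℝ (Fin d)}

lemma aemeasurable_noisyUpdate (hU : Continuous U) (hθ : AEMeasurable θ P)
    (hε : AEMeasurable ε P) (η σ : ℝ) :
    AEMeasurable (fun ω => noisyUpdate U η σ (θ ω) (ε ω)) P :=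
  (hθ.sub ((hU.measurable.comp_aemeasurable hθ).const_smul η)).add (hε.const_smul σ)

lemma ProbabilityTheory.HasLaw.memLp_two_of_isGaussian {X : Ω → EuclideanSpace ℝ (Fin d)}
    {ν : Measure (EuclideanSpace ℝ (Fin d))} [IsGaussian ν] (hX : HasLaw X ν P) :
    MemLp X 2 P := by
  have h : MemLp id 2 (P.map X) := by rw [hX.map_eq]; exact IsGaussian.memLp_two_id
  exact (memLp_map_measure_iff (by fun_prop) hX.aemeasurable).1 h

lemma map_noisyUpdate_le [IsProbabilityMeasure P] (hU : Continuous U) (hθ : AEMeasurable θ P)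
    (hε : HasLaw ε (stdGaussian (EuclideanSpace ℝ (Fin d))) P) (hindep : IndepFun θ ε P)
    (η : ℝ) {σ : ℝ} (hσ : σ ≠ 0) :
    P.map (fun ω => noisyUpdate U η σ (θ ω) (ε ω)) ≤
      ENNReal.ofReal ((|σ| ^ d)⁻¹) • volume := by
  have hT : Measurable fun x => x - η • U x := measurable_id.sub (hU.measurable.const_smul η)
  exact map_add_smul_le_smul_volume (hT.comp_aemeasurable hθ) hε
    (hindep.comp hT measurable_id) hσ

lemma sq_norm_noisyUpdate_le (η σ : ℝ) (x e : EuclideanSpace ℝ (Fin d)) :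
    ‖noisyUpdate U η σ x e‖ ^ 2 ≤
      3 * (‖x‖ ^ 2 + η ^ 2 * ‖U x‖ ^ 2 + σ ^ 2 * ‖e‖ ^ 2) := by
  have h : ‖noisyUpdate U η σ x e‖ ≤ ‖x‖ + |η| * ‖U x‖ + |σ| * ‖e‖ := by
    refine (norm_add_le _ _).trans (add_le_add ((norm_sub_le _ _).trans ?_) ?_)
    · simp [norm_smul]
    · simp [norm_smul]
  have h' := pow_le_pow_left₀ (norm_nonneg _) h 2
  rw [← sq_abs η, ← sq_abs σ]
  nlinarith [sq_nonneg (‖x‖ - |η| * ‖U x‖), sq_nonneg (‖x‖ - |σ| * ‖e‖),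
    sq_nonneg (|η| * ‖U x‖ - |σ| * ‖e‖)]

lemma memLp_lipschitz_comp [IsFiniteMeasure P] {p : ENNReal} {K : NNReal} (hU : LipschitzWith K U)
    (hθ : MemLp θ p P) : MemLp (fun ω => U (θ ω)) p P := by
  -- Subtracting `U 0` gives a Lipschitz map fixing `0`, which preserves `Lᵖ`; constants are in `Lᵖ`
  -- of a finite measure.
  have h := (hU.sub (LipschitzWith.const (U 0))).comp_memLp (by simp) hθ
  refine (h.add (memLp_const (U 0))).ae_eq (ae_of_all _ fun ω => ?_)
  simp

/-- Second moments of the updated state, with a bound uniform in the step size and the noise. -/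
lemma integrable_sq_norm_map_noisyUpdate (hUc : Continuous U) (hθ : MemLp θ 2 P)
    (hU : MemLp (fun ω => U (θ ω)) 2 P) (hε : MemLp ε 2 P) (η σ : ℝ) :
    Integrable (fun x => ‖x‖ ^ 2) (P.map (fun ω => noisyUpdate U η σ (θ ω) (ε ω))) ∧
    ∫ x, ‖x‖ ^ 2 ∂(P.map (fun ω => noisyUpdate U η σ (θ ω) (ε ω))) ≤
      3 * (∫ ω, ‖θ ω‖ ^ 2 ∂P + η ^ 2 * ∫ ω, ‖U (θ ω)‖ ^ 2 ∂P +
        σ ^ 2 * ∫ ω, ‖ε ω‖ ^ 2 ∂P) := by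
  have hm := aemeasurable_noisyUpdate hUc hθ.1.aemeasurable hε.1.aemeasurable η σ
  have iθ := hθ.integrable_norm_pow (p := 2) (by simp)
  have iU := (hU.integrable_norm_pow (p := 2) (by simp)).const_mul (η ^ 2)
  have iε := (hε.integrable_norm_pow (p := 2) (by simp)).const_mul (σ ^ 2)
  have i12 : Integrable (fun ω => ‖θ ω‖ ^ 2 + η ^ 2 * ‖U (θ ω)‖ ^ 2) P := iθ.add iU
  have isum : Integrable (fun ω => 3 * (‖θ ω‖ ^ 2 + η ^ 2 * ‖U (θ ω)‖ ^ 2 +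
      σ ^ 2 * ‖ε ω‖ ^ 2)) P := (i12.add iε).const_mul 3
  have iY : Integrable (fun ω => ‖noisyUpdate U η σ (θ ω) (ε ω)‖ ^ 2) P := by
    refine isum.mono' (hm.norm.pow_const 2).aestronglyMeasurable (ae_of_all _ fun ω => ?_)
    rw [Real.norm_of_nonneg (sq_nonneg _)]
    exact sq_norm_noisyUpdate_le η σ _ _
  have hs : AEStronglyMeasurable (fun x : EuclideanSpace ℝ (Fin d) => ‖x‖ ^ 2)
      (P.map (fun ω => noisyUpdate U η σ (θ ω) (ε ω))) := by fun_prop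
  refine ⟨(integrable_map_measure hs hm).2 iY, ?_⟩
  rw [integral_map hm hs]
  refine (integral_mono iY isum fun ω => sq_norm_noisyUpdate_le η σ _ _).trans (le_of_eq ?_)
  rw [integral_const_mul, integral_add i12 iε, integral_add iθ iU, integral_const_mul,
    integral_const_mul]

/-- The rescaled entropy change vanishes whenever the step size stays convergent as the noise
vanishes. -/
lemma tendsto_sq_mul_systemEntropyChange [IsProbabilityMeasure P] {K : NNReal} (hU : LipschitzWith K U)
    (hθ : MemLp θ 2 P) (hε : HasLaw ε (stdGaussian (EuclideanSpace ℝ (Fin d))) P)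
    (hindep : IndepFun θ ε P) {η : ℝ → ℝ} {η₀ : ℝ} (hη : Tendsto η (𝓝[≠] 0) (𝓝 η₀)) :
    Tendsto (fun σ : ℝ => σ ^ 2 * systemEntropyChange P U θ ε (η σ) σ) (𝓝[≠] 0) (𝓝 0) := by
  have hUθ := memLp_lipschitz_comp hU hθ
  have hε2 := hε.memLp_two_of_isGaussian
  set A := ∫ ω, ‖θ ω‖ ^ 2 ∂P
  set B := ∫ ω, ‖U (θ ω)‖ ^ 2 ∂P
  set D := ∫ ω, ‖ε ω‖ ^ 2 ∂P
  set C := ∫ x : EuclideanSpace ℝ (Fin d), Real.exp (-‖x‖ ^ 2)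
  have hbound : ∀ σ : ℝ, σ ≠ 0 → ‖σ ^ 2 * systemEntropyChange P U θ ε (η σ) σ‖ ≤
      d * (σ ^ 2 * |Real.log σ|) + σ ^ 2 * (3 * (A + η σ ^ 2 * B + σ ^ 2 * D) + C +
        |shannonEntropy (P.map θ)|) := by
    intro σ hσ
    have : IsProbabilityMeasure (P.map (fun ω => noisyUpdate U (η σ) σ (θ ω) (ε ω))) :=
      Measure.isProbabilityMeasure_map
        (aemeasurable_noisyUpdate hU.continuous hθ.1.aemeasurable hε.aemeasurable _ _)
    obtain ⟨hi, hle⟩ :=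
      integrable_sq_norm_map_noisyUpdate hU.continuous hθ hUθ hε2 (η σ) σ
    have hH := abs_shannonEntropy_le (by positivity)
      (map_noisyUpdate_le hU.continuous hθ.1.aemeasurable hε hindep (η σ) hσ) hi
    have hlog : |Real.log (|σ| ^ d)⁻¹| = d * |Real.log σ| := by
      rw [Real.log_inv, Real.log_pow, Real.log_abs, abs_neg, abs_mul, Nat.abs_cast]
    rw [hlog] at hH
    have hS : |systemEntropyChange P U θ ε (η σ) σ| ≤ d * |Real.log σ| +
        (3 * (A + η σ ^ 2 * B + σ ^ 2 * D) + C + |shannonEntropy (P.map θ)|) := by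
      refine (abs_sub _ _).trans ?_
      linarith
    rw [Real.norm_eq_abs, abs_mul, abs_of_nonneg (sq_nonneg σ)]
    calc _ ≤ _ := mul_le_mul_of_nonneg_left hS (sq_nonneg σ)
      _ = _ := by ring
  refine squeeze_zero_norm' (eventually_nhdsWithin_of_forall hbound) ?_
  have hσ : Tendsto (fun σ : ℝ => σ ^ 2) (𝓝[≠] 0) (𝓝 0) := by
    have h := ((continuous_pow 2).tendsto (0 : ℝ)).mono_left
      (nhdsWithin_le_nhds (s := ({0}ᶜ : Set ℝ)))
    simpa using h
  -- The bracket multiplying `σ²` converges because `η` does.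
  have h := (tendsto_sq_mul_log_abs.const_mul (d : ℝ)).add
    (hσ.mul ((((((hη.pow 2).mul_const B).const_add A).add (hσ.mul_const D)).const_mul 3).add_const
      C |>.add_const |shannonEntropy (P.map θ)|))
  simpa using h

end NoisyUpdate

theorem mainTheorem6 {Ω : Type*} [MeasurableSpace Ω] (P : Measure Ω) [IsProbabilityMeasure P]
    (d : ℕ) (U : EuclideanSpace ℝ (Fin d) → EuclideanSpace ℝ (Fin d))
    (hU : ∃ K, LipschitzWith K U)
    (μ : EuclideanSpace ℝ (Fin d)) (τ : ℝ) (hτ : 0 < τ)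
    (θ ε : Ω → EuclideanSpace ℝ (Fin d))
    (hθ : HasLaw θ (multivariateGaussian μ (τ • (1 : Matrix (Fin d) (Fin d) ℝ))) P)
    (hε : HasLaw ε (stdGaussian (EuclideanSpace ℝ (Fin d))) P)
    (hindep : IndepFun θ ε P) :
    HasShannonEntropy (P.map θ) ∧
    (∀ η σ : ℝ, 0 < η → σ ≠ 0 →
      HasShannonEntropy (P.map (fun ω => noisyUpdate U η σ (θ ω) (ε ω)))) ∧
    -- the step size is held fixed
    (∀ η : ℝ, 0 < η →
      Tendsto (fun σ : ℝ => σ ^ 2 * systemEntropyChange P U θ ε η σ) (𝓝[≠] 0) (𝓝 0)) ∧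
    -- the scaling regime `σ² ∝ η`
    (∀ c : ℝ, 0 < c →
      Tendsto (fun σ : ℝ => σ ^ 2 * systemEntropyChange P U θ ε (c * σ ^ 2) σ)
        (𝓝[≠] 0) (𝓝 0)) := by
  obtain ⟨K, hU⟩ := hU
  have hθ2 := hθ.memLp_two_of_isGaussian
  refine ⟨?_, fun η σ _ hσ => ?_, fun η _ => ?_, fun c _ => ?_⟩
  · rw [hθ.map_eq]
    exact hasShannonEntropy_of_le_smul_volume (by positivity)
      (multivariateGaussian_smul_one_le μ hτ)
      (IsGaussian.memLp_two_id.integrable_norm_pow (p := 2) (by simp))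
  · have : IsProbabilityMeasure (P.map (fun ω => noisyUpdate U η σ (θ ω) (ε ω))) :=
      Measure.isProbabilityMeasure_map
        (aemeasurable_noisyUpdate hU.continuous hθ.aemeasurable hε.aemeasurable _ _)
    exact hasShannonEntropy_of_le_smul_volume (by positivity)
      (map_noisyUpdate_le hU.continuous hθ.aemeasurable hε hindep η hσ)
      (integrable_sq_norm_map_noisyUpdate hU.continuous hθ2 (memLp_lipschitz_comp hU hθ2)
        hε.memLp_two_of_isGaussian η σ).1
  · exact tendsto_sq_mul_systemEntropyChange hU hθ2 hε hindep tendsto_const_nhds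
  · have hη : Tendsto (fun σ : ℝ => c * σ ^ 2) (𝓝[≠] 0) (𝓝 (c * 0 ^ 2)) :=
      ((by fun_prop : Continuous fun σ : ℝ => c * σ ^ 2).tendsto 0).mono_left nhdsWithin_le_nhds
    exact tendsto_sq_mul_systemEntropyChange hU hθ2 hε hindep hη
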